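/- Let $n\ge 1$ and consider $n$ servers under the join-the-shortest-queue (JSQ) policy with abandonment: the queue length vector (number of jobs at each server, including the one in service) is the continuous-time Markov chain on $\mathbb{N}^n$ which jumps from $\mathbf{x}$ to $\mathbf{x}+\mathbf{e}_i$ at rate $\lambda>0$, where $i$ is the smallest index with $x_i=\min_j x_j$, and, for each $i$ with $x_i\ge 1$, from $\mathbf{x}$ to $\mathbf{x}-\mathbf{e}_i$ at rate $\mu_i+\gamma x_i$, with service rates $\mu_i>0$ and abandonment rate $\gamma>0$. Put $\mu=\sum_{i=1}^n\mu_i$, and let $\mathbf{q}=(q_1,\dots,q_n)$ be distributed according to the stationary distribution of this chain. Fix $n$, $\mu>0$ and constants $C>1$ and $\alpha\in[0,1/2)$, and assume that the system is heavily overloaded: $$\frac{\lambda}{\mu}-1\ \ge\ C\Big(\frac{\gamma}{\mu}\Big)^{\alpha}.$$ Then: 1. For all sufficiently small $\gamma$, that is, for all $0<\gamma\le\bar\gamma$ with some $\bar\gamma>0$ that depends only on $n,\mu,C,\alpha$ (and neither on $\lambda$ nor on the individual $\mu_i$), $$\sum_{i=1}^n \mathbb{P}(q_i=0)\ \le\ \exp\Big(-\frac{C}{2n\lambda}\cdot\frac{\lambda-\mu}{\sqrt{\gamma}}\Big).$$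 2. For all $\gamma>0$, $$\exp\Big(-\frac{\lambda}{\gamma}\Big)\ \le\ \mathbb{P}\Big(\sum_{i=1}^n q_i=0\Big)\ \le\ C'_{\lambda,\mu}\,\sqrt{\frac{\gamma}{\mu}}\;\exp\Big(-\frac{1}{\gamma/\mu}\Big(\frac{\lambda}{\mu}-1-\ln\frac{\lambda}{\mu}\Big)\Big),$$ where $C'_{\lambda,\mu}=\dfrac{\lambda}{\mu}\max\Big\{e,\ \dfrac{(1+C)(2+C)}{C^2+C-1}\Big\}$. -/

import Mathlib

open scoped ENNReal

noncomputable section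

/-! ### Continuous-time Markov chains on a countable state space -/

/-- Total rate out of `x`, for a kernel `Q` of jump rates (zero on the diagonal). -/
def exitRate {S : Type*} (Q : S → S → ℝ) (x : S) : ℝ := ∑' y, Q x y

open Classical in
/-- `jumpTransition Q x k t y` is the probability that the chain with jump rates `Q`, started
at `x`, has made exactly `k` jumps by time `t` and is then at `y`. With no jump, the chain stays at
`x` for an exponential time of rate `exitRate Q x`; with `k + 1` jumps, one decomposes according to
the time `s` of the last jump, which leads from some `z` to `y`, after which the chain rests
at `y`. -/
def jumpTransition {S : Type*} (Q : S → S → ℝ) (x : S) : ℕ → ℝ → S → ℝ≥0∞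
  | 0, t, y => if y = x then ENNReal.ofReal (Real.exp (-(exitRate Q x * t))) else 0
  | k + 1, t, y =>
      ∫⁻ s in Set.Ioc 0 t, ∑' z, jumpTransition Q x k s z * ENNReal.ofReal (Q z y) *
        ENNReal.ofReal (Real.exp (-(exitRate Q y * (t - s))))

/-- The transition semigroup `P_t(x, y)` of the (minimal) chain with jump rates `Q`. -/
def transitionProb {S : Type*} (Q : S → S → ℝ) (t : ℝ) (x y : S) : ℝ≥0∞ :=
  ∑' k, jumpTransition Q x k t y

/-- `π` is invariant under the transition semigroup: `π P_t = π` for every `t ≥ 0`. -/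
def IsStationaryLaw {S : Type*} [MeasurableSpace S] (Q : S → S → ℝ)
    (π : MeasureTheory.Measure S) : Prop :=
  ∀ t : ℝ, 0 ≤ t → ∀ y : S, ∑' x, π {x} * transitionProb Q t x y = π {y}

/-! ### Join-the-shortest-queue with abandonment -/

/-- `i` is the server of smallest index among those with the shortest queue. -/
def IsShortest {n : ℕ} (x : Fin n → ℕ) (i : Fin n) : Prop :=
  (∀ j, x i ≤ x j) ∧ ∀ j, j < i → x i < x j

open Classical in
/-- Jump rates of the join-the-shortest-queue system with arrival rate `lam`, service rates `μ i`
and abandonment rate `γ` per job: `x → x + e_i` at rate `lam` for the shortest queue `i`, and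
`x → x - e_i` at rate `μ i + γ * x i` for every `i` with `x i ≥ 1` (written `x = y + e_i`). -/
def jsqRate {n : ℕ} (lam : ℝ) (μ : Fin n → ℝ) (γ : ℝ) (x y : Fin n → ℕ) : ℝ :=
  (∑ i, if IsShortest x i ∧ y = x + Pi.single i 1 then lam else 0) +
    ∑ i, if x = y + Pi.single i 1 then μ i + γ * (x i : ℝ) else 0

/-- `π` is the law of a steady-state queue length vector of the join-the-shortest-queue system. -/
structure IsJSQSteadyState {n : ℕ} (lam : ℝ) (μ : Fin n → ℝ) (γ : ℝ)
    (π : MeasureTheory.Measure (Fin n → ℕ)) : Prop where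
  isProbabilityMeasure : MeasureTheory.IsProbabilityMeasure π
  isStationary : IsStationaryLaw (jsqRate lam μ γ) π

/-- Heavily overloaded regime: `lam / μ - 1 ≥ C (γ / μ) ^ α`, for the total service rate `μ`. -/
def HeavilyOverloaded (C α lam μ γ : ℝ) : Prop :=
  C * (γ / μ) ^ α ≤ lam / μ - 1

end

/-! Stationarity under the semigroup yields global balance, and testing it against the indicator of
total length at most `k` yields the cut equation `cut_balance`: `lam * P k` is the mean departure
rate on total length `k + 1`. There the rate lies between `γ * (k + 1)` and `∑ μ i + γ * (k + 1)`,
so the total behaves like a birth-death chain.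

Empty system: iterating the lower rate bounds `P k` by Poisson weights times `P 0`; summing gives
the lower bound `exp (-(lam / γ))`. Iterating the upper one gives `P 0 * G x ≤ 1`, where `G` is the
series of the incomplete gamma function with parameter `a = ∑ μ i / γ`, and `x = lam / γ`. Since
`exp (-t) * t ^ a * G t` increases in `t` and `G a ≥ √a / e`, the upper bound follows with constant
`e`.

Idle servers: `f x = ∑ exp (-θ x j)` has zero mean drift (`integral_drift`). As arrivals join a
shortest queue, their contribution dominates `∑ (μ i + δ) exp (-θ x i)` with `n δ = lam - ∑ μ i`. An
empty server has no departures and so leaves a surplus of at least `δ`; a nonempty one can create a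
deficit only beyond length `δ / (4γ)`, where the exponential is small. Hence idleness is rare
(`sum_measure_idle_le`). Because `α < 1/2`, `δ` exceeds any fixed multiple of `√γ` once `γ` is
small, which absorbs the prefactor and yields the stated exponent. -/

open MeasureTheory

/-! ### Global balance for stationary laws of Markov chains. -/

section MarkovChain

variable {S : Type*} [Countable S] (Q : S → S → ℝ)

theorem measurable_jumpTransition (x : S) (k : ℕ) :
    ∀ y, Measurable fun t => jumpTransition Q x k t y := by
  induction k with
  | zero =>
    intro y
    simp only [jumpTransition]
    split_ifs <;> fun_prop
  | succ k ih =>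
    intro y
    have hm : Measurable fun p : ℝ × ℝ => {p : ℝ × ℝ | p.2 ∈ Set.Ioc 0 p.1}.indicator
        (fun p => ∑' z, jumpTransition Q x k p.2 z * ENNReal.ofReal (Q z y) *
          ENNReal.ofReal (Real.exp (-(exitRate Q y * (p.1 - p.2))))) p := by
      refine Measurable.indicator (Measurable.tsum fun z => ?_) ?_
      · have h1 : Measurable fun p : ℝ × ℝ => jumpTransition Q x k p.2 z :=
          (ih z).comp measurable_snd
        have h2 : Measurable fun p : ℝ × ℝ =>
            ENNReal.ofReal (Real.exp (-(exitRate Q y * (p.1 - p.2)))) := by fun_prop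
        exact (h1.mul_const _).mul h2
      · exact (measurableSet_lt measurable_const measurable_snd).inter
          (measurableSet_le measurable_snd measurable_fst)
    convert hm.lintegral_prod_right' (ν := volume) using 2 with t
    rw [jumpTransition, ← lintegral_indicator measurableSet_Ioc]
    rfl

theorem measurable_transitionProb (x y : S) : Measurable fun t => transitionProb Q t x y :=
  Measurable.tsum fun k => measurable_jumpTransition Q x k y

open Classical in
/-- The integrated Kolmogorov forward equation, decomposing at the last jump. -/
theorem transitionProb_eq_add_lintegral (t : ℝ) (x y : S) :
    transitionProb Q t x y =
      (if y = x then ENNReal.ofReal (Real.exp (-(exitRate Q x * t))) else 0) +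
      ∫⁻ s in Set.Ioc 0 t, ∑' z, transitionProb Q s x z * ENNReal.ofReal (Q z y) *
        ENNReal.ofReal (Real.exp (-(exitRate Q y * (t - s)))) := by
  rw [transitionProb, tsum_eq_zero_add' ENNReal.summable]
  congr 1
  simp only [jumpTransition]
  rw [← lintegral_tsum]
  · refine lintegral_congr fun s => ?_
    rw [ENNReal.tsum_comm]
    refine tsum_congr fun z => ?_
    rw [transitionProb, ENNReal.tsum_mul_right, ENNReal.tsum_mul_right]
  · intro k
    refine (Measurable.tsum fun z => ?_).aemeasurable
    have h2 : Measurable fun s : ℝ =>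
      ENNReal.ofReal (Real.exp (-(exitRate Q y * (t - s)))) := by fun_prop
    exact ((measurable_jumpTransition Q x k z).mul_const _).mul h2

theorem lintegral_exp_neg_mul_one_sub {q : ℝ} (hq : 0 < q) :
    ∫⁻ s in Set.Ioc (0 : ℝ) 1, ENNReal.ofReal (Real.exp (-(q * (1 - s)))) =
      ENNReal.ofReal ((1 - Real.exp (-q)) / q) := by
  have hc : Continuous fun s : ℝ => Real.exp (-(q * (1 - s))) := by fun_prop
  rw [← ofReal_integral_eq_lintegral_ofReal]
  · congr 1
    rw [← intervalIntegral.integral_of_le zero_le_one]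
    have hd : ∀ s ∈ Set.uIcc (0 : ℝ) 1,
        HasDerivAt (fun s => Real.exp (-(q * (1 - s))) / q) (Real.exp (-(q * (1 - s)))) s := by
      intro s _
      have h1 : HasDerivAt (fun s => -(q * (1 - s))) q s := by
        have := (((hasDerivAt_id s).const_sub 1).const_mul q).neg
        simpa [Pi.neg_def] using this
      have := h1.exp.div_const q
      rwa [mul_div_assoc, div_self hq.ne', mul_one] at this
    rw [intervalIntegral.integral_eq_sub_of_hasDerivAt hd (hc.intervalIntegrable _ _)]
    simp
    ring
  · exact (hc.integrableOn_Icc).mono_set Set.Ioc_subset_Icc_self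
  · exact Filter.Eventually.of_forall fun s => (Real.exp_pos _).le

variable {Q} [MeasurableSpace S] {π : Measure S}

/-- Global balance for a stationary law of a continuous-time Markov chain. -/
theorem IsStationaryLaw.global_balance [IsFiniteMeasure π] (h : IsStationaryLaw Q π) {y : S}
    (hy : 0 < exitRate Q y) :
    π {y} * ENNReal.ofReal (exitRate Q y) = ∑' z, π {z} * ENNReal.ofReal (Q z y) := by
  classical
  set q := exitRate Q y with hq
  set I := ∑' z, π {z} * ENNReal.ofReal (Q z y) with hI
  -- Decompose at the last jump before time 1. Stationarity turns the inflow into `y` at each time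
  -- `s` into the constant `I`, so only the integral of the holding factor remains; `1 - exp (-q)`
  -- then cancels.
  have key : π {y} = π {y} * ENNReal.ofReal (Real.exp (-q)) +
      I * ENNReal.ofReal ((1 - Real.exp (-q)) / q) := by
    conv_lhs => rw [← h 1 zero_le_one y]
    simp only [transitionProb_eq_add_lintegral Q 1 _ y, mul_add]
    rw [ENNReal.tsum_add]
    congr 1
    · rw [tsum_eq_single y]
      · simp [hq]
      · intro x hx
        simp [hx.symm]
    · rw [← lintegral_exp_neg_mul_one_sub hy, ← lintegral_const_mul _ (by fun_prop)]
      have hm : ∀ x, Measurable fun s => ∑' z, transitionProb Q s x z * ENNReal.ofReal (Q z y) *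
          ENNReal.ofReal (Real.exp (-(exitRate Q y * (1 - s)))) := by
        intro x
        refine Measurable.tsum fun z => ?_
        have h2 : Measurable fun s : ℝ =>
          ENNReal.ofReal (Real.exp (-(exitRate Q y * (1 - s)))) := by fun_prop
        exact ((measurable_transitionProb Q x z).mul_const _).mul h2
      simp only [← lintegral_const_mul _ (hm _)]
      rw [← lintegral_tsum fun x => ((hm x).const_mul _).aemeasurable]
      refine setLIntegral_congr_fun measurableSet_Ioc fun s hs => ?_
      simp only [← ENNReal.tsum_mul_left]
      rw [ENNReal.tsum_comm, hI, ← ENNReal.tsum_mul_right]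
      refine tsum_congr fun z => ?_
      rw [← h s hs.1.le z, ← ENNReal.tsum_mul_right, ← ENNReal.tsum_mul_right]
      refine tsum_congr fun x => ?_
      ring
  have he : Real.exp (-q) < 1 := by simpa using hy
  have hc : 0 < (1 - Real.exp (-q)) / q := div_pos (by linarith) hy
  -- An infinite inflow would make the right side of `key` infinite, while `π` is finite.
  have hIt : I ≠ ∞ := by
    intro hIt
    rw [hIt, ENNReal.top_mul (by simpa using hc)] at key
    simp at key
  have hreal : (π {y}).toReal = (π {y}).toReal * Real.exp (-q) +
      I.toReal * ((1 - Real.exp (-q)) / q) := by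
    conv_lhs => rw [key]
    rw [ENNReal.toReal_add (ENNReal.mul_ne_top (by simp) (by simp))
      (ENNReal.mul_ne_top hIt (by simp)), ENNReal.toReal_mul, ENNReal.toReal_mul,
      ENNReal.toReal_ofReal (Real.exp_pos _).le, ENNReal.toReal_ofReal hc.le]
  rw [← ENNReal.toReal_eq_toReal_iff' (ENNReal.mul_ne_top (by simp) (by simp)) hIt,
    ENNReal.toReal_mul, ENNReal.toReal_ofReal hy.le]
  have h3 : (π {y}).toReal * (1 - Real.exp (-q)) * q = I.toReal * (1 - Real.exp (-q)) := by
    field_simp at hreal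
    linarith
  have h4 : (1 - Real.exp (-q)) ≠ 0 := by linarith
  apply mul_right_cancel₀ h4
  linarith

/-- Global balance tested against a nonnegative function. -/
theorem IsStationaryLaw.lintegral_mul_exitRate [MeasurableSingletonClass S] [IsFiniteMeasure π]
    (h : IsStationaryLaw Q π) (hQ : ∀ y, 0 < exitRate Q y) (f : S → ℝ≥0∞) :
    ∫⁻ y, f y * ENNReal.ofReal (exitRate Q y) ∂π =
      ∫⁻ z, ∑' y, ENNReal.ofReal (Q z y) * f y ∂π := by
  rw [lintegral_countable', lintegral_countable']
  simp only [← ENNReal.tsum_mul_right]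
  rw [ENNReal.tsum_comm]
  refine tsum_congr fun y => ?_
  rw [mul_assoc, mul_comm _ (π {y}), h.global_balance (hQ y), ← ENNReal.tsum_mul_left]
  refine tsum_congr fun z => ?_
  ring

end MarkovChain

/-! ### Jump structure of the join-the-shortest-queue chain. -/

section JoinShortestQueue

variable {n : ℕ}

theorem exists_isShortest [NeZero n] (x : Fin n → ℕ) : ∃ i, IsShortest x i := by
  obtain ⟨i₀, hi₀⟩ := Finite.exists_min x
  obtain ⟨i, hi, hmin⟩ := wellFounded_lt.has_min {i : Fin n | ∀ j, x i ≤ x j} ⟨i₀, hi₀⟩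
  refine ⟨i, hi, fun j hj => lt_of_le_of_ne (hi j) fun h => hmin j ?_ hj⟩
  exact fun l => h ▸ hi l

theorem IsShortest.eq {x : Fin n → ℕ} {i j : Fin n} (hi : IsShortest x i) (hj : IsShortest x j) :
    i = j := by
  rcases lt_trichotomy i j with h | h | h
  · exact absurd (hi.1 j) (not_le.2 (hj.2 i h))
  · exact h
  · exact absurd (hj.1 i) (not_le.2 (hi.2 j h))

/-- The server joined by a job arriving in state `x`. -/
noncomputable def shortest [NeZero n] (x : Fin n → ℕ) : Fin n := (exists_isShortest x).choose

theorem isShortest_iff [NeZero n] (x : Fin n → ℕ) (i : Fin n) :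
    IsShortest x i ↔ i = shortest x :=
  ⟨fun h => h.eq (exists_isShortest x).choose_spec, fun h => h ▸ (exists_isShortest x).choose_spec⟩

theorem shortest_le [NeZero n] (x : Fin n → ℕ) (j : Fin n) : x (shortest x) ≤ x j :=
  ((isShortest_iff x _).2 rfl).1 j

/-- The departure rate from server `i` in state `x`. -/
def departureRate (μ : Fin n → ℝ) (γ : ℝ) (x : Fin n → ℕ) (i : Fin n) : ℝ :=
  if x i = 0 then 0 else μ i + γ * x i

variable {lam γ : ℝ} {μ : Fin n → ℝ}

theorem departureRate_nonneg (hμ : ∀ i, 0 < μ i) (hγ : 0 < γ) (x : Fin n → ℕ) (i : Fin n) :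
    0 ≤ departureRate μ γ x i := by
  have := hμ i
  unfold departureRate; split_ifs <;> positivity

theorem departureRate_le (hμ : ∀ i, 0 < μ i) (x : Fin n → ℕ) (i : Fin n) :
    departureRate μ γ x i ≤ μ i + γ * x i := by
  have := hμ i
  unfold departureRate; split_ifs with h
  · simp [h, this.le]
  · rfl

theorem le_departureRate (hμ : ∀ i, 0 < μ i) (x : Fin n → ℕ) (i : Fin n) :
    γ * x i ≤ departureRate μ γ x i := by
  have := hμ i
  unfold departureRate; split_ifs with h
  · simp [h]
  · linarith

theorem eq_add_single_iff {x y : Fin n → ℕ} {i : Fin n} :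
    x = y + Pi.single i 1 ↔ x i ≠ 0 ∧ y = x - Pi.single i 1 := by
  constructor
  · rintro rfl
    simp
  · rintro ⟨h, rfl⟩
    ext j
    rcases eq_or_ne j i with rfl | hj
    · simp; omega
    · simp [hj]

/-- Parametrising jumps by their source makes sums over `y` collapse to single terms. The truncated
subtraction is harmless: for `x i = 0` the departure rate vanishes. -/
theorem jsqRate_eq [NeZero n] (x y : Fin n → ℕ) :
    jsqRate lam μ γ x y = (if y = x + Pi.single (shortest x) 1 then lam else 0) +
      ∑ i, if y = x - Pi.single i 1 then departureRate μ γ x i else 0 := by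
  classical
  unfold jsqRate
  congr 1
  · rw [Finset.sum_eq_single (shortest x)]
    · simp [isShortest_iff]
    · intro i _ hi
      simp [isShortest_iff, hi]
    · simp
  · refine Finset.sum_congr rfl fun i _ => ?_
    rw [departureRate]
    simp only [eq_add_single_iff]
    by_cases h : x i = 0 <;> simp [h]

theorem exitRate_jsqRate [NeZero n] (x : Fin n → ℕ) :
    exitRate (jsqRate lam μ γ) x = lam + ∑ i, departureRate μ γ x i := by
  classical
  unfold exitRate
  simp only [jsqRate_eq]
  exact ((hasSum_ite_eq _ _).add (hasSum_sum fun i _ => hasSum_ite_eq _ _)).tsum_eq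

theorem tsum_ofReal_jsqRate_mul [NeZero n] (hlam : 0 < lam) (hμ : ∀ i, 0 < μ i) (hγ : 0 < γ)
    (x : Fin n → ℕ) (f : (Fin n → ℕ) → ℝ≥0∞) :
    ∑' y, ENNReal.ofReal (jsqRate lam μ γ x y) * f y =
      ENNReal.ofReal lam * f (x + Pi.single (shortest x) 1) +
        ∑ i, ENNReal.ofReal (departureRate μ γ x i) * f (x - Pi.single i 1) := by
  classical
  have hd := departureRate_nonneg hμ hγ x
  have h1 : ∀ y, ENNReal.ofReal (jsqRate lam μ γ x y) * f y =
      (if y = x + Pi.single (shortest x) 1 then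
        ENNReal.ofReal lam * f (x + Pi.single (shortest x) 1) else 0) +
      ∑ i, if y = x - Pi.single i 1 then
        ENNReal.ofReal (departureRate μ γ x i) * f (x - Pi.single i 1) else 0 := by
    intro y
    rw [jsqRate_eq, ENNReal.ofReal_add, ENNReal.ofReal_sum_of_nonneg, add_mul, Finset.sum_mul]
    · congr 1
      · split_ifs with h <;> simp [h]
      · refine Finset.sum_congr rfl fun i _ => ?_
        split_ifs with h <;> simp [h]
    · intro i _; split_ifs <;> simp [hd]
    · split_ifs <;> simp [hlam.le]
    · refine Finset.sum_nonneg fun i _ => ?_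
      split_ifs <;> simp [hd]
  simp only [h1]
  rw [ENNReal.tsum_add, Summable.tsum_finsetSum fun _ _ => ENNReal.summable]
  simp [tsum_ite_eq]

/-! ### Stationary balance, cut equations and mean drift. -/

variable {π : Measure (Fin n → ℕ)}

/-- The stationary balance equation tested against a nonnegative function. -/
theorem IsJSQSteadyState.lintegral_balance [NeZero n] (h : IsJSQSteadyState lam μ γ π)
    (hlam : 0 < lam) (hμ : ∀ i, 0 < μ i) (hγ : 0 < γ) (f : (Fin n → ℕ) → ℝ≥0∞) :
    ∫⁻ x, f x * ENNReal.ofReal lam + f x * ENNReal.ofReal (∑ i, departureRate μ γ x i) ∂π =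
      ∫⁻ x, ENNReal.ofReal lam * f (x + Pi.single (shortest x) 1) +
        ∑ i, ENNReal.ofReal (departureRate μ γ x i) * f (x - Pi.single i 1) ∂π := by
  have := h.isProbabilityMeasure
  have hD : ∀ x, 0 ≤ ∑ i, departureRate μ γ x i := fun x =>
    Finset.sum_nonneg fun i _ => departureRate_nonneg hμ hγ x i
  have key := h.isStationary.lintegral_mul_exitRate (fun y => by
    rw [exitRate_jsqRate]; linarith [hD y]) f
  simp only [tsum_ofReal_jsqRate_mul hlam hμ hγ] at key
  rw [← key]
  refine lintegral_congr fun x => ?_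
  rw [exitRate_jsqRate, ENNReal.ofReal_add hlam.le (hD x), mul_add]

theorem sum_add_single (x : Fin n → ℕ) (i : Fin n) :
    ∑ j, (x + Pi.single i 1 : Fin n → ℕ) j = ∑ j, x j + 1 := by
  simp [Finset.sum_add_distrib]

theorem sum_sub_single {x : Fin n → ℕ} {i : Fin n} (hi : x i ≠ 0) :
    ∑ j, (x - Pi.single i 1 : Fin n → ℕ) j + 1 = ∑ j, x j := by
  have : x = (x - Pi.single i 1) + Pi.single i 1 := eq_add_single_iff.2 ⟨hi, rfl⟩
  conv_rhs => rw [this, sum_add_single]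

/-- Balance of the flows across the cut between total queue length `k` and `k + 1`. -/
theorem IsJSQSteadyState.cut_balance [NeZero n] (h : IsJSQSteadyState lam μ γ π)
    (hlam : 0 < lam) (hμ : ∀ i, 0 < μ i) (hγ : 0 < γ) (k : ℕ) :
    ENNReal.ofReal lam * π {x | ∑ i, x i = k} =
      ∫⁻ x in {x | ∑ i, x i = k + 1}, ENNReal.ofReal (∑ i, departureRate μ γ x i) ∂π := by
  classical
  have := h.isProbabilityMeasure
  have hd := departureRate_nonneg hμ hγ
  have hms : ∀ s : Set (Fin n → ℕ), MeasurableSet s := fun s => s.to_countable.measurableSet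
  set A : Set (Fin n → ℕ) := {x | ∑ i, x i ≤ k}
  set L := ENNReal.ofReal lam
  set D : (Fin n → ℕ) → ℝ≥0∞ := fun x => ENNReal.ofReal (∑ i, departureRate μ γ x i) with hD
  set E : Set (Fin n → ℕ) := {x | ∑ i, x i = k}
  set F : Set (Fin n → ℕ) := {x | ∑ i, x i = k + 1}
  set B : Set (Fin n → ℕ) := {x | ∑ i, x i + 1 ≤ k}
  have key := h.lintegral_balance hlam hμ hγ (A.indicator 1)
  have e1 : ∀ x, A.indicator 1 x * L + A.indicator 1 x * D x =
      E.indicator (fun _ => L) x + (B.indicator (fun _ => L) x + A.indicator D x) := by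
    -- `E` is the top layer of `A` and `B` the rest; only arrivals in `E` leave `A`, and only
    -- departures from `F` enter it. All other flow is common to both sides.
    intro x
    have : (x ∈ A ∧ x ∈ E ∧ x ∉ B) ∨ (x ∈ A ∧ x ∉ E ∧ x ∈ B) ∨ (x ∉ A ∧ x ∉ E ∧ x ∉ B) := by
      simp only [A, E, B, Set.mem_ofPred_eq]; omega
    rcases this with h | h | h <;> simp [Set.indicator, h]
  have e2 : ∀ x, L * A.indicator 1 (x + Pi.single (shortest x) 1) +
      ∑ i, ENNReal.ofReal (departureRate μ γ x i) * A.indicator 1 (x - Pi.single i 1) =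
      F.indicator D x + (B.indicator (fun _ => L) x + A.indicator D x) := by
    intro x
    have h1 : L * A.indicator 1 (x + Pi.single (shortest x) 1) = B.indicator (fun _ => L) x := by
      simp only [Set.indicator, A, B, Set.mem_ofPred_eq, sum_add_single]
      split_ifs <;> simp
    have h2 : ∀ i, ENNReal.ofReal (departureRate μ γ x i) * A.indicator 1 (x - Pi.single i 1) =
        (A ∪ F).indicator (fun x => ENNReal.ofReal (departureRate μ γ x i)) x := by
      intro i
      by_cases hi : x i = 0
      · simp [departureRate, hi, Set.indicator]
      · have := sum_sub_single hi
        have hiff : x - Pi.single i 1 ∈ A ↔ x ∈ A ∪ F := by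
          simp only [A, F, Set.mem_union, Set.mem_ofPred_eq]; omega
        simp only [Set.indicator, hiff]
        split_ifs <;> simp
    rw [h1]
    simp only [h2]
    have h3 : ∑ i, (A ∪ F).indicator (fun x => ENNReal.ofReal (departureRate μ γ x i)) x =
        (A ∪ F).indicator D x := by
      simp only [Set.indicator, hD]
      split_ifs
      · rw [ENNReal.ofReal_sum_of_nonneg fun i _ => hd x i]
      · simp
    have hdisj : Disjoint A F := Set.disjoint_left.2 fun x hx hx' => by
      simp only [A, F, Set.mem_ofPred_eq] at hx hx'; omega
    rw [h3, Set.indicator_union_of_disjoint hdisj]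
    ring
  -- The common flow can be cancelled in `ℝ≥0∞` because `A` is a finite set, on which the rates are
  -- bounded.
  have hfin : ∫⁻ x, (B.indicator (fun _ => L) x + A.indicator D x) ∂π ≠ ∞ := by
    have hAfin : A.Finite := by
      refine (Set.Finite.pi fun _ : Fin n => Set.finite_Iic k).subset fun x hx i _ => ?_
      exact (Finset.single_le_sum (fun j _ => Nat.zero_le (x j)) (Finset.mem_univ i)).trans hx
    rw [lintegral_add_left (measurable_of_countable _), lintegral_indicator (hms _),
      lintegral_indicator (hms _)]
    refine ENNReal.add_ne_top.2 ⟨by simp [L, ENNReal.mul_ne_top], ?_⟩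
    obtain ⟨M, hM⟩ := (hAfin.image fun x => ∑ i, departureRate μ γ x i).bddAbove
    refine ((setLIntegral_mono' (hms A) (g := fun _ => ENNReal.ofReal M) fun x hx =>
      ENNReal.ofReal_le_ofReal (hM ⟨x, hx, rfl⟩)).trans_lt ?_).ne
    simp [ENNReal.mul_lt_top_iff]
  replace key := (lintegral_congr (μ := π) e1).symm.trans (key.trans (lintegral_congr e2))
  rw [lintegral_add_left (measurable_of_countable _),
    lintegral_add_left (f := F.indicator D) (measurable_of_countable _)] at key
  rw [ENNReal.add_left_inj hfin, lintegral_indicator (hms _), lintegral_indicator (hms _)] at key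
  simpa using key

/-- Summing the cut equations over `k` shows that the mean departure rate is `lam`. This
integrability is what permits subtracting the two sides of the balance equation for bounded
functions. -/
theorem IsJSQSteadyState.lintegral_departureRate_ne_top [NeZero n]
    (h : IsJSQSteadyState lam μ γ π) (hlam : 0 < lam) (hμ : ∀ i, 0 < μ i) (hγ : 0 < γ) :
    ∫⁻ x, ENNReal.ofReal (∑ i, departureRate μ γ x i) ∂π ≠ ∞ := by
  have := h.isProbabilityMeasure
  have hms : ∀ s : Set (Fin n → ℕ), MeasurableSet s := fun s => s.to_countable.measurableSet
  have hcov : (⋃ k : ℕ, {x : Fin n → ℕ | ∑ i, x i = k}) = Set.univ := by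
    ext x; simp
  have hdisj : Pairwise (Function.onFun Disjoint fun k : ℕ => {x : Fin n → ℕ | ∑ i, x i = k}) :=
    fun k l hkl => Set.disjoint_left.2 fun x hx hx' => hkl (hx.symm.trans hx')
  rw [← setLIntegral_univ, ← hcov, lintegral_iUnion (fun _ => hms _) hdisj,
    tsum_eq_zero_add' ENNReal.summable]
  simp only [← h.cut_balance hlam hμ hγ]
  rw [ENNReal.tsum_mul_left, ← measure_iUnion hdisj (fun _ => hms _), hcov]
  have h0 : ∫⁻ x in {x : Fin n → ℕ | ∑ i, x i = 0},
      ENNReal.ofReal (∑ i, departureRate μ γ x i) ∂π = 0 := by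
    rw [setLIntegral_congr_fun (g := fun _ => 0) (hms _)]
    · simp
    · intro x hx
      have : ∀ i, x i = 0 := by simpa using hx
      simp [departureRate, this]
  rw [h0]
  simp

theorem IsJSQSteadyState.integrable_departureRate [NeZero n]
    (h : IsJSQSteadyState lam μ γ π) (hlam : 0 < lam) (hμ : ∀ i, 0 < μ i) (hγ : 0 < γ) :
    Integrable (fun x => ∑ i, departureRate μ γ x i) π := by
  refine ⟨(measurable_of_countable _).aestronglyMeasurable, ?_⟩
  rw [hasFiniteIntegral_iff_ofReal (Filter.Eventually.of_forall fun x =>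
    Finset.sum_nonneg fun i _ => departureRate_nonneg hμ hγ x i)]
  exact (h.lintegral_departureRate_ne_top hlam hμ hγ).lt_top

/-- The stationary mean drift of a bounded nonnegative function vanishes. -/
theorem IsJSQSteadyState.integral_drift [NeZero n] (h : IsJSQSteadyState lam μ γ π)
    (hlam : 0 < lam) (hμ : ∀ i, 0 < μ i) (hγ : 0 < γ) {f : (Fin n → ℕ) → ℝ} {M : ℝ}
    (hf0 : ∀ x, 0 ≤ f x) (hfM : ∀ x, f x ≤ M) :
    Integrable (fun x => lam * (f x - f (x + Pi.single (shortest x) 1)) +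
        ∑ i, departureRate μ γ x i * (f x - f (x - Pi.single i 1))) π ∧
    ∫ x, (lam * (f x - f (x + Pi.single (shortest x) 1)) +
        ∑ i, departureRate μ γ x i * (f x - f (x - Pi.single i 1))) ∂π = 0 := by
  have := h.isProbabilityMeasure
  have hd := departureRate_nonneg hμ hγ
  have hM : 0 ≤ M := (hf0 0).trans (hfM 0)
  have hI := h.integrable_departureRate hlam hμ hγ
  have hdom : Integrable (fun x => M * lam + M * ∑ i, departureRate μ γ x i) π :=
    (integrable_const _).add (hI.const_mul _)
  set u : (Fin n → ℕ) → ℝ := fun x => f x * lam + f x * ∑ i, departureRate μ γ x i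
  set v : (Fin n → ℕ) → ℝ := fun x => lam * f (x + Pi.single (shortest x) 1) +
        ∑ i, departureRate μ γ x i * f (x - Pi.single i 1)
  have hD : ∀ x, 0 ≤ ∑ i, departureRate μ γ x i := fun x => Finset.sum_nonneg fun i _ => hd x i
  have hu0 : ∀ x, 0 ≤ u x := fun x =>
    add_nonneg (mul_nonneg (hf0 x) hlam.le) (mul_nonneg (hf0 x) (hD x))
  have hv0 : ∀ x, 0 ≤ v x := fun x =>
    add_nonneg (mul_nonneg hlam.le (hf0 _))
      (Finset.sum_nonneg fun i _ => mul_nonneg (hd x i) (hf0 _))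
  have hu : Integrable u π := by
    refine hdom.mono' (measurable_of_countable _).aestronglyMeasurable
      (Filter.Eventually.of_forall fun x => ?_)
    rw [Real.norm_of_nonneg (hu0 x)]
    exact add_le_add (mul_le_mul_of_nonneg_right (hfM x) hlam.le)
      (mul_le_mul_of_nonneg_right (hfM x) (hD x))
  have hv : Integrable v π := by
    refine hdom.mono' (measurable_of_countable _).aestronglyMeasurable
      (Filter.Eventually.of_forall fun x => ?_)
    rw [Real.norm_of_nonneg (hv0 x), mul_comm M lam, Finset.mul_sum]
    refine add_le_add (mul_le_mul_of_nonneg_left (hfM _) hlam.le) (Finset.sum_le_sum fun i _ => ?_)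
    rw [mul_comm M]
    exact mul_le_mul_of_nonneg_left (hfM _) (hd x i)
  have huv : ∫ x, u x ∂π = ∫ x, v x ∂π := by
    rw [integral_eq_lintegral_of_nonneg_ae (Filter.Eventually.of_forall hu0) hu.1,
      integral_eq_lintegral_of_nonneg_ae (Filter.Eventually.of_forall hv0) hv.1]
    congr 1
    have key := h.lintegral_balance hlam hμ hγ fun x => ENNReal.ofReal (f x)
    convert key using 2
    · ext x
      rw [ENNReal.ofReal_add (mul_nonneg (hf0 x) hlam.le) (mul_nonneg (hf0 x) (hD x)),
        ENNReal.ofReal_mul (hf0 x), ENNReal.ofReal_mul (hf0 x)]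
    · ext x
      rw [ENNReal.ofReal_add (mul_nonneg hlam.le (hf0 _))
        (Finset.sum_nonneg fun i _ => mul_nonneg (hd x i) (hf0 _)),
        ENNReal.ofReal_sum_of_nonneg fun i _ => mul_nonneg (hd x i) (hf0 _),
        ENNReal.ofReal_mul hlam.le]
      simp only [ENNReal.ofReal_mul (hd x _)]
  have huveq : (fun x => lam * (f x - f (x + Pi.single (shortest x) 1)) +
        ∑ i, departureRate μ γ x i * (f x - f (x - Pi.single i 1))) = fun x => u x - v x := by
    ext x
    simp only [u, v, mul_sub, Finset.sum_sub_distrib, Finset.mul_sum]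
    have : ∀ i, f x * departureRate μ γ x i = departureRate μ γ x i * f x := fun i => mul_comm _ _
    simp only [this]
    ring
  rw [huveq]
  exact ⟨hu.sub hv, by rw [integral_sub hu hv, huv, sub_self]⟩

end JoinShortestQueue

/-! ### Lower bounds for the incomplete gamma series. -/

section IncompleteGamma

/-- Partial sums of `∑ k, t ^ k / ((a + 1) ⋯ (a + k))`, the Kummer-type series of the lower
incomplete gamma function. -/
noncomputable def gammaSeries (a : ℝ) (N : ℕ) (t : ℝ) : ℝ :=
  ∑ k ∈ Finset.range N, t ^ k / ∏ j ∈ Finset.range k, (a + (j + 1))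

variable {a : ℝ}

theorem prod_add_succ_pos (ha : 0 < a) (k : ℕ) : 0 < ∏ j ∈ Finset.range k, (a + ((j : ℝ) + 1)) :=
  Finset.prod_pos fun j _ => by positivity

/-- The derivative of the partial sums satisfies the recursion of the incomplete gamma function. -/
theorem hasDerivAt_gammaSeries (ha : 0 < a) (N : ℕ) (t : ℝ) :
    ∃ d, HasDerivAt (gammaSeries a (N + 1)) d t ∧
      t * d + a * gammaSeries a (N + 1) t = a + t * gammaSeries a N t := by
  induction N with
  | zero =>
    refine ⟨0, ?_, ?_⟩
    · have : gammaSeries a (0 + 1) = fun _ => 1 := by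
        ext t; simp [gammaSeries]
      rw [this]; exact hasDerivAt_const _ _
    · simp [gammaSeries]
  | succ N ih =>
    obtain ⟨d, hd, he⟩ := ih
    have hs : ∀ N t, gammaSeries a (N + 1) t =
        gammaSeries a N t + t ^ N / ∏ j ∈ Finset.range N, (a + (j + 1)) := fun N t => by
      rw [gammaSeries, Finset.sum_range_succ]; rfl
    refine ⟨d + (N + 1) * t ^ N / ∏ j ∈ Finset.range (N + 1), (a + (j + 1)), ?_, ?_⟩
    · have : gammaSeries a (N + 1 + 1) = fun t => gammaSeries a (N + 1) t +
          t ^ (N + 1) / ∏ j ∈ Finset.range (N + 1), (a + (j + 1)) := by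
        ext t; exact hs _ _
      rw [this]
      refine hd.add ?_
      have := (hasDerivAt_pow (N + 1) t).div_const (∏ j ∈ Finset.range (N + 1), (a + ((j : ℝ) + 1)))
      simpa using this
    · rw [hs (N + 1)]
      have hp := (prod_add_succ_pos ha N).ne'
      have hN : a + ((N : ℝ) + 1) ≠ 0 := by positivity
      have : t * ((N + 1) * t ^ N / ∏ j ∈ Finset.range (N + 1), (a + ((j : ℝ) + 1))) +
          a * (t ^ (N + 1) / ∏ j ∈ Finset.range (N + 1), (a + ((j : ℝ) + 1))) =
          t * (t ^ N / ∏ j ∈ Finset.range N, (a + ((j : ℝ) + 1))) := by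
        rw [Finset.prod_range_succ]
        field_simp
        ring
      have h2 := hs N t
      rw [h2] at he ⊢
      linear_combination he + this

theorem tendsto_pow_div_prod_add_succ (ha : 0 < a) {x : ℝ} (hx : 0 ≤ x) :
    Filter.Tendsto (fun N : ℕ => x ^ N / ∏ j ∈ Finset.range N, (a + ((j : ℝ) + 1)))
      Filter.atTop (nhds 0) := by
  refine squeeze_zero (fun N => div_nonneg (by positivity) (prod_add_succ_pos ha N).le)
    (fun N => ?_) (FloorSemiring.tendsto_pow_div_factorial_atTop x)
  gcongr
  rw [← Finset.prod_range_add_one_eq_factorial]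
  push_cast
  exact Finset.prod_le_prod (fun _ _ => by positivity) fun _ _ => by linarith

/-- By the recursion, the derivative is `exp (-t) * t ^ (a - 1)` times `a - t * (t ^ N / ∏ (a + j +
1))`. The subtracted truncation error increases with `t`, so controlling it at `x` suffices. -/
theorem monotoneOn_gammaSeries (ha : 0 < a) {x : ℝ} {N : ℕ}
    (hN : x * (x ^ N / ∏ j ∈ Finset.range N, (a + ((j : ℝ) + 1))) ≤ a) :
    MonotoneOn (fun t => Real.exp (-t) * t ^ a * gammaSeries a (N + 1) t) (Set.Icc a x) := by
  have hderiv : ∀ t ∈ Set.Icc a x, ∃ d, HasDerivAt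
      (fun t => Real.exp (-t) * t ^ a * gammaSeries a (N + 1) t) d t ∧ 0 ≤ d := by
    intro t ht
    have ht0 : 0 < t := ha.trans_le ht.1
    obtain ⟨d, hd, he⟩ := hasDerivAt_gammaSeries ha N t
    have h1 : HasDerivAt (fun t : ℝ => Real.exp (-t)) (-Real.exp (-t)) t := by
      simpa using (hasDerivAt_neg t).exp
    have h2 := Real.hasDerivAt_rpow_const (x := t) (p := a) (Or.inl ht0.ne')
    refine ⟨_, (h1.mul h2).mul hd, ?_⟩
    have hs : gammaSeries a (N + 1) t =
        gammaSeries a N t + t ^ N / ∏ j ∈ Finset.range N, (a + (j + 1)) := by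
      rw [gammaSeries, Finset.sum_range_succ]; rfl
    have h3 : t * (t ^ N / ∏ j ∈ Finset.range N, (a + ((j : ℝ) + 1))) ≤ a := by
      refine le_trans ?_ hN
      have := prod_add_succ_pos ha N
      gcongr <;> first | exact ht.2 | linarith [ht.2]
    have h4 : 0 ≤ t * d + a * gammaSeries a (N + 1) t - t * gammaSeries a (N + 1) t := by
      rw [he, hs]; linarith
    have h5 : t ^ a = t ^ (a - 1) * t := by
      rw [← Real.rpow_add_one ht0.ne']; ring_nf
    rw [h5]
    have h6 : 0 ≤ Real.exp (-t) * t ^ (a - 1) := by positivity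
    have := mul_nonneg h6 h4
    simp only [Pi.mul_apply] at *
    rw [h5]
    linarith
  choose! D hD hD0 using hderiv
  refine monotoneOn_of_deriv_nonneg (convex_Icc a x)
    (fun t ht => (hD t ht).continuousAt.continuousWithinAt) ?_ ?_
  · rw [interior_Icc]
    exact fun t ht => (hD t (Set.Ioo_subset_Icc_self ht)).differentiableAt.differentiableWithinAt
  · rw [interior_Icc]
    intro t ht
    rw [(hD t (Set.Ioo_subset_Icc_self ht)).deriv]
    exact hD0 t (Set.Ioo_subset_Icc_self ht)

/-- Apply `1 + u ≤ exp u` with `u = (j + 1) / a` to each factor; the exponents sum to `k (k + 1) /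
(2a)`. -/
theorem prod_add_succ_div_pow_le (ha : 0 < a) (k : ℕ) :
    ∏ j ∈ Finset.range k, (a + ((j : ℝ) + 1)) ≤ a ^ k * Real.exp (k * (k + 1) / (2 * a)) := by
  induction k with
  | zero => simp
  | succ k ih =>
    rw [Finset.prod_range_succ]
    have h1 : a + ((k : ℝ) + 1) ≤ a * Real.exp ((k + 1) / a) := by
      have := Real.add_one_le_exp (((k : ℝ) + 1) / a)
      calc a + ((k : ℝ) + 1) = a * ((k + 1) / a + 1) := by field_simp; ring
        _ ≤ _ := by gcongr
    calc _ ≤ (a ^ k * Real.exp (k * (k + 1) / (2 * a))) * (a * Real.exp ((k + 1) / a)) := by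
          gcongr
      _ = a ^ (k + 1) * (Real.exp (k * (k + 1) / (2 * a)) * Real.exp ((k + 1) / a)) := by ring
      _ = _ := by
        rw [← Real.exp_add]; congr 2; push_cast; field_simp; ring

/-- For `k < √a` one has `k (k + 1) ≤ 2a`, so each of the first `⌈√a⌉` terms is at least `1 / e`. -/
theorem sqrt_le_gammaSeries_self (ha : 0 < a) {N : ℕ} (hN : Real.sqrt a ≤ N) :
    Real.sqrt a ≤ Real.exp 1 * gammaSeries a N a := by
  have hs0 : 0 < Real.sqrt a := Real.sqrt_pos.2 ha
  have hss : Real.sqrt a * Real.sqrt a = a := Real.mul_self_sqrt ha.le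
  have hterm : ∀ k ∈ Finset.range ⌈Real.sqrt a⌉₊,
      Real.exp (-1) ≤ a ^ k / ∏ j ∈ Finset.range k, (a + ((j : ℝ) + 1)) := by
    intro k hk
    have hk' : (k : ℝ) < Real.sqrt a := Nat.lt_ceil.1 (Finset.mem_range.1 hk)
    rw [le_div_iff₀ (prod_add_succ_pos ha k)]
    have hle : (k : ℝ) * (k + 1) / (2 * a) ≤ 1 := by
      rw [div_le_one (by positivity)]
      rcases Nat.eq_zero_or_pos k with rfl | hk0
      · simp [ha.le]
      · have : (1 : ℝ) ≤ k := by exact_mod_cast hk0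
        nlinarith
    calc _ ≤ Real.exp (-1) * (a ^ k * Real.exp (k * (k + 1) / (2 * a))) := by
          gcongr; exact prod_add_succ_div_pow_le ha k
      _ ≤ Real.exp (-1) * (a ^ k * Real.exp 1) := by gcongr
      _ = a ^ k * (Real.exp (-1) * Real.exp 1) := by ring
      _ = a ^ k := by rw [← Real.exp_add]; simp
  have hsum : ⌈Real.sqrt a⌉₊ * Real.exp (-1) ≤ gammaSeries a N a := by
    calc _ = ∑ k ∈ Finset.range ⌈Real.sqrt a⌉₊, Real.exp (-1) := by simp
      _ ≤ ∑ k ∈ Finset.range ⌈Real.sqrt a⌉₊,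
          a ^ k / ∏ j ∈ Finset.range k, (a + ((j : ℝ) + 1)) := Finset.sum_le_sum hterm
      _ ≤ _ := Finset.sum_le_sum_of_subset_of_nonneg
          (Finset.range_subset_range.2 (Nat.ceil_le.2 hN))
          fun k _ _ => div_nonneg (by positivity) (prod_add_succ_pos ha k).le
  calc Real.sqrt a ≤ ⌈Real.sqrt a⌉₊ := Nat.le_ceil _
    _ = Real.exp 1 * (⌈Real.sqrt a⌉₊ * Real.exp (-1)) := by
        rw [mul_left_comm, ← Real.exp_add]; simp
    _ ≤ _ := by gcongr

/-- Lower bound for the incomplete gamma series away from the mode. -/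
theorem exists_le_gammaSeries (ha : 0 < a) {x : ℝ} (hx : a ≤ x) :
    ∃ N, Real.sqrt a * Real.exp (x - a - a * Real.log (x / a)) ≤
      Real.exp 1 * gammaSeries a N x := by
  have hx0 : 0 < x := ha.trans_le hx
  have h1 := (tendsto_pow_div_prod_add_succ ha hx0.le).const_mul x
  rw [mul_zero] at h1
  obtain ⟨N, hN, hN2⟩ := ((h1.eventually (ge_mem_nhds ha)).and
    (Filter.eventually_ge_atTop ⌈Real.sqrt a⌉₊)).exists
  refine ⟨N + 1, ?_⟩
  have hmon := monotoneOn_gammaSeries ha hN (Set.left_mem_Icc.2 hx) (Set.right_mem_Icc.2 hx) hx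
  have hself := sqrt_le_gammaSeries_self ha (N := N + 1) (by
    have := Nat.ceil_le.1 hN2
    push_cast; linarith)
  -- The large-deviation exponent is the log-ratio of the weight `exp (-t) * t ^ a` at `t = a` and
  -- at `t = x`.
  have hE : Real.exp (x - a - a * Real.log (x / a)) * (Real.exp (-x) * x ^ a) =
      Real.exp (-a) * a ^ a := by
    rw [Real.rpow_def_of_pos hx0, Real.rpow_def_of_pos ha, Real.log_div hx0.ne' ha.ne',
      ← Real.exp_add, ← Real.exp_add, ← Real.exp_add]
    congr 1; ring
  have hpos : 0 < Real.exp (-x) * x ^ a := by positivity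
  have hpos' : 0 < Real.exp (-a) * a ^ a := by positivity
  simp only at hmon
  refine le_of_mul_le_mul_right ?_ hpos
  rw [mul_assoc, hE]
  calc _ ≤ Real.exp 1 * gammaSeries a (N + 1) a * (Real.exp (-a) * a ^ a) := by gcongr
    _ = Real.exp 1 * (Real.exp (-a) * a ^ a * gammaSeries a (N + 1) a) := by ring
    _ ≤ Real.exp 1 * (Real.exp (-x) * x ^ a * gammaSeries a (N + 1) x) := by gcongr
    _ = _ := by ring

end IncompleteGamma

/-! ### Probability of an empty system. -/

section SteadyState

variable {n : ℕ} {lam γ : ℝ} {μ : Fin n → ℝ} {π : Measure (Fin n → ℕ)}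

/-- Abandonment alone gives departure rate `γ * (k + 1)`, however the jobs are distributed. -/
theorem IsJSQSteadyState.le_cut [NeZero n] (h : IsJSQSteadyState lam μ γ π)
    (hlam : 0 < lam) (hμ : ∀ i, 0 < μ i) (hγ : 0 < γ) (k : ℕ) :
    γ * (k + 1) * π.real {x | ∑ i, x i = k + 1} ≤ lam * π.real {x | ∑ i, x i = k} := by
  have := h.isProbabilityMeasure
  have hms : MeasurableSet {x : Fin n → ℕ | ∑ i, x i = k + 1} :=
    (Set.to_countable _).measurableSet
  have hcut := h.cut_balance hlam hμ hγ k
  have hle : ENNReal.ofReal (γ * (k + 1)) * π {x | ∑ i, x i = k + 1} ≤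
      ENNReal.ofReal lam * π {x | ∑ i, x i = k} := by
    rw [hcut, ← setLIntegral_const]
    refine setLIntegral_mono' hms fun x hx => ENNReal.ofReal_le_ofReal ?_
    have hx' : ((∑ i, x i : ℕ) : ℝ) = k + 1 := by exact_mod_cast congrArg (Nat.cast (R := ℝ)) hx
    rw [← hx', Nat.cast_sum, Finset.mul_sum]
    exact Finset.sum_le_sum fun i _ => le_departureRate hμ x i
  have := ENNReal.toReal_mono (ENNReal.mul_ne_top (by simp) (by simp)) hle
  rwa [ENNReal.toReal_mul, ENNReal.toReal_mul, ENNReal.toReal_ofReal (by positivity),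
    ENNReal.toReal_ofReal hlam.le] at this

/-- The departure rate is largest when no server is idle. -/
theorem IsJSQSteadyState.cut_le [NeZero n] (h : IsJSQSteadyState lam μ γ π)
    (hlam : 0 < lam) (hμ : ∀ i, 0 < μ i) (hγ : 0 < γ) (k : ℕ) :
    lam * π.real {x | ∑ i, x i = k} ≤
      (∑ i, μ i + γ * (k + 1)) * π.real {x | ∑ i, x i = k + 1} := by
  have := h.isProbabilityMeasure
  have hms : MeasurableSet {x : Fin n → ℕ | ∑ i, x i = k + 1} :=
    (Set.to_countable _).measurableSet
  have hμ0 : 0 ≤ ∑ i, μ i := Finset.sum_nonneg fun i _ => (hμ i).le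
  have hcut := h.cut_balance hlam hμ hγ k
  have hle : ENNReal.ofReal lam * π {x | ∑ i, x i = k} ≤
      ENNReal.ofReal (∑ i, μ i + γ * (k + 1)) * π {x | ∑ i, x i = k + 1} := by
    rw [hcut, ← setLIntegral_const]
    refine setLIntegral_mono' hms fun x hx => ENNReal.ofReal_le_ofReal ?_
    have hx' : ((∑ i, x i : ℕ) : ℝ) = k + 1 := by exact_mod_cast congrArg (Nat.cast (R := ℝ)) hx
    rw [← hx', Nat.cast_sum, Finset.mul_sum, ← Finset.sum_add_distrib]
    exact Finset.sum_le_sum fun i _ => departureRate_le hμ x i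
  have := ENNReal.toReal_mono (ENNReal.mul_ne_top (by simp) (by simp)) hle
  rwa [ENNReal.toReal_mul, ENNReal.toReal_mul, ENNReal.toReal_ofReal hlam.le,
    ENNReal.toReal_ofReal (by positivity)] at this

theorem hasSum_measureReal_sum_eq (π : Measure (Fin n → ℕ)) [IsProbabilityMeasure π] :
    HasSum (fun k : ℕ => π.real {x | ∑ i, x i = k}) 1 := by
  have hms : ∀ s : Set (Fin n → ℕ), MeasurableSet s := fun s => s.to_countable.measurableSet
  have hcov : (⋃ k : ℕ, {x : Fin n → ℕ | ∑ i, x i = k}) = Set.univ := by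
    ext x; simp
  have hdisj : Pairwise (Function.onFun Disjoint fun k : ℕ => {x : Fin n → ℕ | ∑ i, x i = k}) :=
    fun k l hkl => Set.disjoint_left.2 fun x hx hx' => hkl (hx.symm.trans hx')
  have h1 : ∑' k : ℕ, π {x | ∑ i, x i = k} = 1 := by
    rw [← measure_iUnion hdisj (fun _ => hms _), hcov, measure_univ]
  have := ENNReal.hasSum_toReal (h1.trans_ne ENNReal.one_ne_top)
  rwa [← ENNReal.tsum_toReal_eq (fun _ => measure_ne_top _ _), h1, ENNReal.toReal_one] at this

theorem IsJSQSteadyState.exp_le_measure_empty [NeZero n] (h : IsJSQSteadyState lam μ γ π)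
    (hlam : 0 < lam) (hμ : ∀ i, 0 < μ i) (hγ : 0 < γ) :
    Real.exp (-(lam / γ)) ≤ π.real {x | ∑ i, x i = 0} := by
  have := h.isProbabilityMeasure
  set P : ℕ → ℝ := fun k => π.real {x | ∑ i, x i = k} with hP
  have hle : ∀ k, P k ≤ (lam / γ) ^ k / (k.factorial : ℝ) * P 0 := by
    intro k
    induction k with
    | zero => simp
    | succ k ih =>
      have hc : γ * (k + 1) * P (k + 1) ≤ lam * P k := h.le_cut hlam hμ hγ k
      have : P (k + 1) ≤ lam / (γ * (k + 1)) * P k := by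
        rw [div_mul_eq_mul_div, le_div_iff₀ (by positivity)]; linarith
      refine this.trans ((mul_le_mul_of_nonneg_left ih (by positivity)).trans_eq ?_)
      rw [Nat.factorial_succ, pow_succ]; push_cast; field_simp
  have hexp : HasSum (fun k : ℕ => (lam / γ) ^ k / (k.factorial : ℝ)) (Real.exp (lam / γ)) := by
    rw [Real.exp_eq_exp_ℝ]; exact NormedSpace.expSeries_div_hasSum_exp _
  have := hasSum_le hle (hasSum_measureReal_sum_eq π) (hexp.mul_right _)
  rw [Real.exp_neg, inv_le_iff_one_le_mul₀' (Real.exp_pos _)]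
  exact this

theorem IsJSQSteadyState.measure_empty_mul_gammaSeries_le [NeZero n]
    (h : IsJSQSteadyState lam μ γ π) (hlam : 0 < lam) (hμ : ∀ i, 0 < μ i) (hγ : 0 < γ) (N : ℕ) :
    π.real {x | ∑ i, x i = 0} * gammaSeries ((∑ i, μ i) / γ) N (lam / γ) ≤ 1 := by
  have := h.isProbabilityMeasure
  have hμ0 : 0 < ∑ i, μ i := Finset.sum_pos (fun i _ => hμ i) Finset.univ_nonempty
  set m := ∑ i, μ i
  have ha : 0 < m / γ := by positivity
  set P : ℕ → ℝ := fun k => π.real {x | ∑ i, x i = k} with hP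
  have hle : ∀ k, P 0 * ((lam / γ) ^ k / ∏ j ∈ Finset.range k, (m / γ + ((j : ℝ) + 1))) ≤ P k := by
    intro k
    induction k with
    | zero => simp
    | succ k ih =>
      have hc : lam * P k ≤ (m + γ * (k + 1)) * P (k + 1) := h.cut_le hlam hμ hγ k
      have hp := prod_add_succ_pos ha k
      have h1 : lam / (m + γ * (k + 1)) * P k ≤ P (k + 1) := by
        rw [div_mul_eq_mul_div, div_le_iff₀ (by positivity)]; linarith
      refine le_trans (le_of_eq ?_) ((mul_le_mul_of_nonneg_left ih (by positivity)).trans h1)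
      rw [Finset.prod_range_succ, pow_succ]
      have h2 : m / γ + ((k : ℝ) + 1) = (m + γ * (k + 1)) / γ := by field_simp
      rw [h2]
      field_simp
  rw [gammaSeries, Finset.mul_sum]
  refine (Finset.sum_le_sum fun k _ => hle k).trans ?_
  exact sum_le_hasSum _ (fun _ _ => measureReal_nonneg) (hasSum_measureReal_sum_eq π)

theorem IsJSQSteadyState.measure_empty_le [NeZero n] (h : IsJSQSteadyState lam μ γ π)
    (hμ : ∀ i, 0 < μ i) (hγ : 0 < γ) (hle : ∑ i, μ i ≤ lam) :
    π.real {x | ∑ i, x i = 0} ≤ Real.exp 1 * Real.sqrt (γ / ∑ i, μ i) *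
      Real.exp (-(1 / (γ / ∑ i, μ i) *
        (lam / ∑ i, μ i - 1 - Real.log (lam / ∑ i, μ i)))) := by
  have hμ0 : 0 < ∑ i, μ i := Finset.sum_pos (fun i _ => hμ i) Finset.univ_nonempty
  have hlam : 0 < lam := hμ0.trans_le hle
  have hG := h.measure_empty_mul_gammaSeries_le hlam hμ hγ
  set m := ∑ i, μ i
  set p := π.real {x | ∑ i, x i = 0}
  have ha : 0 < m / γ := by positivity
  obtain ⟨N, hN⟩ := exists_le_gammaSeries ha (x := lam / γ) (by gcongr)
  have hexp : lam / γ - m / γ - m / γ * Real.log (lam / γ / (m / γ)) =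
      1 / (γ / m) * (lam / m - 1 - Real.log (lam / m)) := by
    rw [div_div_div_cancel_right₀ hγ.ne']
    field_simp
  rw [hexp] at hN
  set T := 1 / (γ / m) * (lam / m - 1 - Real.log (lam / m))
  have h1 : p * (Real.sqrt (m / γ) * Real.exp T) ≤ Real.exp 1 := by
    have hp : 0 ≤ p := measureReal_nonneg
    calc _ ≤ p * (Real.exp 1 * gammaSeries (m / γ) N (lam / γ)) := by gcongr
      _ = Real.exp 1 * (p * gammaSeries (m / γ) N (lam / γ)) := by ring
      _ ≤ Real.exp 1 * 1 := by gcongr; exact hG N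
      _ = _ := mul_one _
  have h2 : Real.sqrt (γ / m) = (Real.sqrt (m / γ))⁻¹ := by
    rw [← Real.sqrt_inv, inv_div]
  rw [h2, Real.exp_neg, mul_assoc, ← mul_inv, ← div_eq_mul_inv, le_div_iff₀ (by positivity)]
  exact h1

/-! ### Idle servers via an exponential Lyapunov function. -/

/-- From `u ≤ exp u` with `u = θ (z - c)`; it bounds the drift deficit of a queue longer than `c`.
-/
theorem mul_exp_neg_mul_le {θ c : ℝ} (hθ : 0 < θ) (z : ℝ) :
    (z - c) * Real.exp (-(θ * z)) ≤ 1 / θ * Real.exp (-(θ * c)) := by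
  have h1 : θ * (z - c) ≤ Real.exp (θ * (z - c)) := by
    linarith [Real.add_one_le_exp (θ * (z - c))]
  have h2 : Real.exp (-(θ * c)) = Real.exp (θ * (z - c)) * Real.exp (-(θ * z)) := by
    rw [← Real.exp_add]; ring_nf
  rw [h2, ← mul_assoc]
  gcongr
  rw [one_div, ← div_eq_inv_mul, le_div_iff₀ hθ]; linarith

/-- Drift of `x ↦ ∑ j, exp (-θ x j)`. -/
theorem drift_sum_exp_neg [NeZero n] (θ : ℝ) (x : Fin n → ℕ) :
    lam * (∑ j, Real.exp (-(θ * x j)) -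
        ∑ j, Real.exp (-(θ * (x + Pi.single (shortest x) 1 : Fin n → ℕ) j))) +
      ∑ i, departureRate μ γ x i * (∑ j, Real.exp (-(θ * x j)) -
        ∑ j, Real.exp (-(θ * (x - Pi.single i 1 : Fin n → ℕ) j))) =
    (1 - Real.exp (-θ)) * (lam * Real.exp (-(θ * x (shortest x))) -
      ∑ i, Real.exp θ * departureRate μ γ x i * Real.exp (-(θ * x i))) := by
  have hup : ∀ i, ∑ j, Real.exp (-(θ * x j)) -
      ∑ j, Real.exp (-(θ * (x + Pi.single i 1 : Fin n → ℕ) j)) =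
      (1 - Real.exp (-θ)) * Real.exp (-(θ * x i)) := by
    intro i
    rw [← Finset.sum_sub_distrib, Finset.sum_eq_single i]
    · have : Real.exp (-(θ * (x + Pi.single i 1 : Fin n → ℕ) i)) =
          Real.exp (-θ) * Real.exp (-(θ * x i)) := by
        rw [← Real.exp_add]; congr 1; simp; ring
      rw [this]; ring
    · intro j _ hj; simp [hj]
    · simp
  have hdown : ∀ i, departureRate μ γ x i * (∑ j, Real.exp (-(θ * x j)) -
        ∑ j, Real.exp (-(θ * (x - Pi.single i 1 : Fin n → ℕ) j))) =
      -((1 - Real.exp (-θ)) * (Real.exp θ * departureRate μ γ x i * Real.exp (-(θ * x i)))) := by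
    intro i
    by_cases hi : x i = 0
    · simp [departureRate, hi]
    · obtain ⟨y, hy⟩ : ∃ y : Fin n → ℕ, x = y + Pi.single i 1 :=
        ⟨_, eq_add_single_iff.2 ⟨hi, rfl⟩⟩
      rw [← Finset.sum_sub_distrib, Finset.sum_eq_single i]
      · have h1 : ((x - Pi.single i 1 : Fin n → ℕ) i : ℝ) = x i - 1 := by
          rw [hy]; simp
        have h2 : Real.exp (-(θ * (x i - 1))) = Real.exp θ * Real.exp (-(θ * x i)) := by
          rw [← Real.exp_add]; congr 1; ring
        have h3 : Real.exp (-θ) * Real.exp θ = 1 := by rw [← Real.exp_add]; simp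
        rw [h1, h2]
        linear_combination (-departureRate μ γ x i * Real.exp (-(θ * x i))) * h3
      · intro j _ hj; simp [hj]
      · simp
  rw [hup]
  simp only [hdown]
  rw [Finset.sum_neg_distrib, ← Finset.mul_sum]
  ring

theorem IsJSQSteadyState.sum_measure_idle_le [NeZero n] (h : IsJSQSteadyState lam μ γ π)
    (hμ : ∀ i, 0 < μ i) (hγ : 0 < γ) {δ θ : ℝ} (hδ : 0 < δ)
    (hlam : ∑ i, μ i + n * δ = lam) (hθ : 0 < θ) (hθ2 : Real.exp θ ≤ 2)
    (hθμ : (Real.exp θ - 1) * ∑ i, μ i ≤ δ / 2) :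
    δ * ∑ i, π.real {x | x i = 0} ≤
      n * (2 * γ * (1 / θ * Real.exp (-(θ * (δ / (4 * γ)))))) := by
  have := h.isProbabilityMeasure
  have hμ0 : 0 < ∑ i, μ i := Finset.sum_pos (fun i _ => hμ i) Finset.univ_nonempty
  have hlam0 : 0 < lam := by rw [← hlam]; positivity
  set K := 2 * γ * (1 / θ * Real.exp (-(θ * (δ / (4 * γ))))) with hK
  have hK0 : 0 < K := by positivity
  have hms : ∀ s : Set (Fin n → ℕ), MeasurableSet s := fun s => s.to_countable.measurableSet
  obtain ⟨hint, hzero⟩ := h.integral_drift hlam0 hμ hγ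
    (f := fun x => ∑ j, Real.exp (-(θ * x j))) (M := n)
    (fun x => Finset.sum_nonneg fun j _ => (Real.exp_pos _).le) (fun x => by
      refine (Finset.sum_le_card_nsmul _ _ 1 fun j _ => ?_).trans_eq (by simp)
      rw [Real.exp_le_one_iff]
      have : 0 ≤ θ * x j := by positivity
      linarith)
  simp only [drift_sum_exp_neg] at hint hzero
  have hε : 0 < 1 - Real.exp (-θ) := by
    have : Real.exp (-θ) < 1 := by simpa using hθ
    linarith
  rw [integral_const_mul] at hzero
  have hzero' := (mul_eq_zero.1 hzero).resolve_left hε.ne'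
  have hint' := (integrable_const_mul_iff (Ne.isUnit hε.ne') _).1 hint
  have hpt : ∀ x : Fin n → ℕ,
      δ * ∑ i, {x : Fin n → ℕ | x i = 0}.indicator (fun _ => (1 : ℝ)) x - n * K ≤
      lam * Real.exp (-(θ * x (shortest x))) -
      ∑ i, Real.exp θ * departureRate μ γ x i * Real.exp (-(θ * x i)) := by
    intro x
    -- Here the routing policy enters: splitting `lam` as `∑ (μ i + δ)`, each share is weighted by
    -- the exponential at the minimum, the largest of all.
    have h1 : ∑ i, (μ i + δ) * Real.exp (-(θ * x i)) ≤
        lam * Real.exp (-(θ * x (shortest x))) := by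
      have : lam = ∑ i, (μ i + δ) := by rw [← hlam, Finset.sum_add_distrib]; simp
      rw [this, Finset.sum_mul]
      refine Finset.sum_le_sum fun i _ => ?_
      have h2 : (x (shortest x) : ℝ) ≤ x i := by exact_mod_cast shortest_le x i
      have h3 := hμ i
      gcongr
    have h2 : ∀ i, δ * {x : Fin n → ℕ | x i = 0}.indicator (fun _ => (1 : ℝ)) x - K ≤
        (μ i + δ) * Real.exp (-(θ * x i)) -
          Real.exp θ * departureRate μ γ x i * Real.exp (-(θ * x i)) := by
      intro i
      have hi := hμ i
      by_cases hx : x i = 0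
      · simp [hx, departureRate]; linarith
      · have hm := mul_exp_neg_mul_le (c := δ / (4 * γ)) hθ (x i)
        have h3 : K ≥ (2 * γ * x i - δ / 2) * Real.exp (-(θ * x i)) := by
          calc _ = 2 * γ * ((x i - δ / (4 * γ)) * Real.exp (-(θ * x i))) := by
                field_simp; ring
            _ ≤ K := by rw [hK]; gcongr
        have h4 : (Real.exp θ - 1) * μ i ≤ δ / 2 := by
          refine le_trans ?_ hθμ
          have : 0 ≤ Real.exp θ - 1 := by linarith [Real.add_one_le_exp θ]
          gcongr
          exact Finset.single_le_sum (fun j _ => (hμ j).le) (Finset.mem_univ i)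
        have h5 : Real.exp θ * (γ * x i) ≤ 2 * (γ * x i) := by gcongr
        have h6 : -(2 * γ * x i - δ / 2) ≤
            (μ i + δ) - Real.exp θ * (μ i + γ * x i) := by linarith
        have h7 := mul_le_mul_of_nonneg_right h6 (Real.exp_pos (-(θ * x i))).le
        simp [hx, departureRate]
        linarith
    have h3 := Finset.sum_le_sum fun i (_ : i ∈ Finset.univ) => h2 i
    rw [Finset.sum_sub_distrib, Finset.sum_sub_distrib, ← Finset.mul_sum] at h3
    simp only [Finset.sum_const, Finset.card_univ, Fintype.card_fin, nsmul_eq_mul] at h3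
    linarith
  have hind : ∀ i : Fin n, Integrable
      ({x : Fin n → ℕ | x i = 0}.indicator fun _ => (1 : ℝ)) π := fun i =>
    (integrable_const _).indicator (hms _)
  have hsum : Integrable (fun x => δ * ∑ i, {x : Fin n → ℕ | x i = 0}.indicator
      (fun _ => (1 : ℝ)) x) π := (integrable_finsetSum _ fun i _ => hind i).const_mul δ
  have hmono := integral_mono (hsum.sub (integrable_const (n * K))) hint' hpt
  have hleft : ∫ x, (δ * ∑ i, {x : Fin n → ℕ | x i = 0}.indicator (fun _ => (1 : ℝ)) x - n * K) ∂π
      = δ * ∑ i, π.real {x | x i = 0} - n * K := by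
    rw [integral_sub hsum (integrable_const _), integral_const_mul,
      integral_finsetSum _ fun i _ => hind i]
    simp [integral_indicator_const, hms]
  rw [hzero'] at hmono
  have := hleft.symm.le.trans hmono
  linarith

theorem exists_forall_mul_sqrt_le {c m K α : ℝ} (hc : 0 < c) (hm : 0 < m) (hK : 0 < K)
    (hα : α < 1 / 2) :
    ∃ γbar : ℝ, 0 < γbar ∧ γbar ≤ 1 ∧
      ∀ γ, 0 < γ → γ ≤ γbar → K * Real.sqrt γ ≤ c * (γ / m) ^ α := by
  have hβ : 0 < 1 / 2 - α := by linarith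
  set b := c / (K * Real.sqrt m)
  have hb : 0 < b := by positivity
  -- The second entry solves `(γ / m) ^ (1/2 - α) = b`; the cap at 1 ensures `√γ ≤ 1` for later use.
  refine ⟨min 1 (m * b ^ (1 / 2 - α)⁻¹), by positivity, min_le_left _ _, fun γ hγ hγb => ?_⟩
  have h1 : γ / m ≤ b ^ (1 / 2 - α)⁻¹ := by
    rw [div_le_iff₀ hm, mul_comm]; exact hγb.trans (min_le_right _ _)
  have hr : 0 < γ / m := by positivity
  have h2 : (γ / m) ^ (1 / 2 - α) ≤ b := by
    rwa [← Real.le_rpow_inv_iff_of_pos hr.le hb.le hβ]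
  have h3 : Real.sqrt γ = Real.sqrt m * ((γ / m) ^ (1 / 2 - α) * (γ / m) ^ α) := by
    rw [← Real.rpow_add hr, sub_add_cancel, ← Real.sqrt_eq_rpow, ← Real.sqrt_mul hm.le,
      mul_div_cancel₀ _ hm.ne']
  rw [h3]
  calc _ ≤ K * (Real.sqrt m * (b * (γ / m) ^ α)) := by gcongr
    _ = _ := by simp only [b]; field_simp

theorem IsJSQSteadyState.sum_measure_idle_le_exp [NeZero n] (h : IsJSQSteadyState lam μ γ π)
    (hμ : ∀ i, 0 < μ i) (hγ : 0 < γ) (hγ1 : γ ≤ 1) {C δ : ℝ} (hC : 0 < C)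
    (hlam : ∑ i, μ i + n * δ = lam)
    (hδ : (16 * n * ∑ i, μ i + 16 * n ^ 2 + 8 * C) * Real.sqrt γ ≤ δ) :
    ∑ i, π.real {x | x i = 0} ≤
      Real.exp (-(C / (2 * n * lam) * ((n * δ) / Real.sqrt γ))) := by
  have hμ0 : 0 < ∑ i, μ i := Finset.sum_pos (fun i _ => hμ i) Finset.univ_nonempty
  have hn : (1 : ℝ) ≤ n := by exact_mod_cast NeZero.one_le
  have hs : 0 < Real.sqrt γ := Real.sqrt_pos.2 hγ
  have hss : Real.sqrt γ * Real.sqrt γ = γ := Real.mul_self_sqrt hγ.le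
  have hs1 : Real.sqrt γ ≤ 1 := Real.sqrt_le_one.2 hγ1
  set m := ∑ i, μ i
  set s := Real.sqrt γ
  have hδ1 : 8 * C * s ≤ δ := by
    have : 0 ≤ (16 * n * m + 16 * (n : ℝ) ^ 2) * s := by positivity
    linarith
  have hδ0 : 0 < δ := lt_of_lt_of_le (by positivity) hδ1
  have hlam0 : 0 < lam := by rw [← hlam]; positivity
  have hδ2 : 16 * (n : ℝ) ^ 2 * s ≤ δ := by
    have : 0 ≤ (16 * n * m + 8 * C) * s := by positivity
    linarith
  -- The first two terms of the constant in `hδ` make the prefactor at most 1: each controls one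
  -- half of `lam = m + n δ`. The term `8 * C` is kept for the exponent.
  have hδ3 : 8 * n * γ * lam ≤ δ ^ 2 := by
    have h1 : 16 * n * m * s ≤ δ := by
      have : 0 ≤ (16 * (n : ℝ) ^ 2 + 8 * C) * s := by positivity
      linarith
    have h2 : s ≤ δ := by
      have : 1 * s ≤ (n : ℝ) ^ 2 * s := by gcongr; exact one_le_pow₀ hn
      linarith
    have h3 : 16 * n * m * s * s ≤ δ * δ := by gcongr
    have h4 : 16 * (n : ℝ) ^ 2 * s * s * δ ≤ δ * 1 * δ := by gcongr
    rw [← hlam, ← hss]; linarith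
  have hδlam : δ ≤ lam := by nlinarith
  -- With `exp θ - 1 ≤ 2θ`, this choice gives `(exp θ - 1) * m ≤ δ / 2`, and the exponent becomes `δ
  -- ^ 2 / (16 lam γ)`.
  set θ := δ / (4 * lam) with hθ
  have hθ0 : 0 < θ := by positivity
  have hθ1 : θ ≤ 1 / 4 := by
    rw [hθ, div_le_iff₀ (by positivity)]; linarith
  have hexp : Real.exp θ - 1 ≤ 2 * θ := by
    have := Real.abs_exp_sub_one_le (x := θ) (by rw [abs_of_pos hθ0]; linarith)
    rw [abs_of_pos hθ0] at this
    exact (le_abs_self _).trans this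
  have key := h.sum_measure_idle_le hμ hγ hδ0 hlam hθ0 (by linarith) (by
    have hm : m ≤ lam := by rw [← hlam]; linarith [mul_pos (by linarith : (0 : ℝ) < n) hδ0]
    calc _ ≤ 2 * θ * lam := by gcongr
      _ = δ / 2 := by rw [hθ]; field_simp; ring)
  have h1 : ∑ i, π.real {x | x i = 0} ≤
      8 * n * γ * lam / δ ^ 2 * Real.exp (-(θ * (δ / (4 * γ)))) := by
    rw [← mul_le_mul_iff_right₀ hδ0]
    refine key.trans_eq ?_
    rw [hθ]; field_simp; ring
  refine h1.trans ?_
  have h2 : 8 * n * γ * lam / δ ^ 2 ≤ 1 := (div_le_one (by positivity)).2 hδ3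
  refine (mul_le_of_le_one_left (Real.exp_pos _).le h2).trans ?_
  rw [Real.exp_le_exp, neg_le_neg_iff]
  have h3 : C / (2 * n * lam) * (n * δ / s) = 8 * C * s * δ / (16 * lam * γ) := by
    rw [← hss]; field_simp; ring
  have h4 : θ * (δ / (4 * γ)) = δ * δ / (16 * lam * γ) := by
    rw [hθ]; field_simp; ring
  rw [h3, h4]
  gcongr

end SteadyState

/-! ### The main theorem. -/

theorem proposition6p4 (n : ℕ) (C α μtot : ℝ) (hC : 1 < C) (hα0 : 0 ≤ α) (hα : α < 1 / 2)
    (hμtot : 0 < μtot) :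
    (∃ γbar : ℝ, 0 < γbar ∧
      ∀ (γ lam : ℝ) (μ : Fin n → ℝ) (π : MeasureTheory.Measure (Fin n → ℕ)),
        0 < γ → γ ≤ γbar → 0 < lam → (∀ i, 0 < μ i) → ∑ i, μ i = μtot →
        HeavilyOverloaded C α lam μtot γ → IsJSQSteadyState lam μ γ π →
        ∑ i, π.real {x | x i = 0}
          ≤ Real.exp (-(C / (2 * n * lam) * ((lam - μtot) / Real.sqrt γ)))) ∧
    (∀ (γ lam : ℝ) (μ : Fin n → ℝ) (π : MeasureTheory.Measure (Fin n → ℕ)),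
        0 < γ → 0 < lam → (∀ i, 0 < μ i) → ∑ i, μ i = μtot →
        HeavilyOverloaded C α lam μtot γ → IsJSQSteadyState lam μ γ π →
        Real.exp (-(lam / γ)) ≤ π.real {x | ∑ i, x i = 0} ∧
        π.real {x | ∑ i, x i = 0}
          ≤ lam / μtot * max (Real.exp 1) ((1 + C) * (2 + C) / (C ^ 2 + C - 1)) *
            Real.sqrt (γ / μtot) *
            Real.exp (-(1 / (γ / μtot) * (lam / μtot - 1 - Real.log (lam / μtot))))) := by
  -- The empty sum would contradict a positive total service rate.
  have hn : ∀ μ : Fin n → ℝ, ∑ i, μ i = μtot → NeZero n := by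
    rintro μ hμ
    refine ⟨?_⟩
    rintro rfl
    simp at hμ
    exact hμtot.ne hμ
  refine ⟨?_, ?_⟩
  · rcases Nat.eq_zero_or_pos n with rfl | hn0
    · exact ⟨1, one_pos, fun γ lam μ π _ _ _ _ hsum => absurd rfl (hn μ hsum).out⟩
    have hn0' : (0 : ℝ) < n := by exact_mod_cast hn0
    obtain ⟨γbar, hpos, hle1, hγbar⟩ := exists_forall_mul_sqrt_le (c := C * μtot / n)
      (K := 16 * n * μtot + 16 * n ^ 2 + 8 * C) (by positivity) hμtot (by positivity) hα
    refine ⟨γbar, hpos, fun γ lam μ π hγ hγb hlam hμ hsum hheavy h => ?_⟩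
    have := hn μ hsum
    have hover : C * μtot / n * (γ / μtot) ^ α ≤ (lam - μtot) / n := by
      have h1 : C * (γ / μtot) ^ α * μtot ≤ (lam / μtot - 1) * μtot :=
        mul_le_mul_of_nonneg_right hheavy hμtot.le
      rw [sub_mul, div_mul_cancel₀ _ hμtot.ne', one_mul] at h1
      rw [div_mul_eq_mul_div]
      gcongr
      linarith
    have key := h.sum_measure_idle_le_exp hμ hγ (hγb.trans hle1) (C := C) (δ := (lam - μtot) / n)
      (by linarith) (by rw [hsum]; field_simp; ring)
      (by rw [hsum]; exact (hγbar γ hγ hγb).trans hover)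
    rwa [mul_div_cancel₀ _ hn0'.ne'] at key
  · intro γ lam μ π hγ hlam hμ hsum hheavy h
    have := hn μ hsum
    have hρ : 1 ≤ lam / μtot := by
      have h1 : 0 ≤ C * (γ / μtot) ^ α := by positivity
      have h2 : C * (γ / μtot) ^ α ≤ lam / μtot - 1 := hheavy
      linarith
    refine ⟨h.exp_le_measure_empty hlam hμ hγ, ?_⟩
    have key := h.measure_empty_le hμ hγ (by rw [hsum]; rwa [one_le_div hμtot] at hρ)
    rw [hsum] at key
    refine key.trans ?_
    gcongr
    -- The bound already holds with constant `e`; since `lam / μtot ≥ 1`, the stated constant is at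
    -- least as large.
    calc Real.exp 1 = 1 * Real.exp 1 := (one_mul _).symm
      _ ≤ _ := mul_le_mul hρ (le_max_left _ _) (Real.exp_pos _).le (by linarith)
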